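/- **Notation.** For a nonzero vector $v=(v_1,\dots,v_m)\in\mathbb R^m$ put $s=1$ if $v_1\ge 0$ and $s=-1$ if $v_1<0$, let $u=v+s\|v\|e_1$ ($\|\cdot\|$ the Euclidean norm), and define the Householder reflector $H(v)=-s\,\bigl(I_m-2\,uu^{\mathsf T}/(u^{\mathsf T}u)\bigr)$; put $H(0)=I_m$. For $p\in\mathbb R^n$ and $1\le k\le n$ let $H_k(p)=\operatorname{diag}\bigl(I_{k-1},\,H(p_k,\dots,p_n)\bigr)$. $\mathrm{Haar}(n)$ is the Haar probability measure on the orthogonal group $\mathbb O(n)$, and $\mathrm{Ginibre}(n,1)$ is the law of a vector in $\mathbb R^n$ with i.i.d. standard normal entries. **Dynamics.** Fix integers $n,d\ge 0$ and $0\le T\le n$, Borel measurable functions $f_t:\mathbb R^n\times(\mathbb R^n)^{d+1}\to\mathbb R^n$ for $1\le t\le T$, and for each $1\le t\le T$ a deterministic choice of whether $M_t=Q$ or $M_t=Q^{\mathsf T}$. The dynamics is $$x_{t+1}=f_t(M_tx_t,\,x_t,\,x_{t-1},\dots,x_{t-d}),\qquad 1\le t\le T,$$ started from an initial condition $(x_t)_{1-d\le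 t\le 1}$, which may be random. **Householder Dice algorithm for $\mathrm{Haar}(n)$.** Let $g_1,\dots,g_T\sim\mathrm{Ginibre}(n,1)$ be independent of each other and of the initial condition. Set $L_0=R_0=I_n$. For $t=1,\dots,T$: - if $M_t=Q$, set $p_t=R_{t-1}\cdots R_1R_0x_t$, $R_t=H_t(p_t)$, $L_t=H_t(g_t)$, $y_t=L_1\cdots L_tR_tp_t$; - if $M_t=Q^{\mathsf T}$, set $p_t=L_{t-1}\cdots L_1L_0x_t$, $L_t=H_t(p_t)$, $R_t=H_t(g_t)$, $y_t=R_1\cdots R_tL_tp_t$; - in both cases set $x_{t+1}=f_t(y_t,x_t,x_{t-1},\dots,x_{t-d})$. **Theorem.** Let $\{x_t:1-d\le t\le T+1\}$ be generated by this algorithm. Let $\{\widetilde x_t:1-d\le t\le T+1\}$ be generated by the dynamics above with the same initial condition ($\widetilde x_t=x_t$ for $1-d\le t\le 1$, or, more generally, $(\widetilde x_t)_{1-d\le t\le 1}$ has the same joint law as $(x_t)_{1-d\le t\le 1}$), where $Q\sim\mathrm{Haar}(n)$ is drawn in advance, independently of the initial condition $(\widetilde x_t)_{1-d\le t\le 1}$.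 Then $\{x_t\}_{1-d\le t\le T+1}$ and $\{\widetilde x_t\}_{1-d\le t\le T+1}$ have the same joint distribution. -/

import Mathlib

open MeasureTheory ProbabilityTheory

namespace HouseholderDice

noncomputable section

/-- Vectors in `ℝⁿ`. Only the topology and Borel structure of this type are used; the Euclidean
norm is written explicitly as `‖WithLp.toLp 2 v‖`. -/
abbrev Vec (n : ℕ) : Type := Fin n → ℝ

/-- The orthogonal group `𝕆(n)`, with its topology as a set of matrices. -/
abbrev OGroup (n : ℕ) : Type := Matrix.orthogonalGroup (Fin n) ℝ

instance instMeasurableSpaceOGroup (n : ℕ) : MeasurableSpace (OGroup n) := borel _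

instance instBorelSpaceOGroup (n : ℕ) : BorelSpace (OGroup n) := ⟨rfl⟩

instance instCompactSpaceOGroup (n : ℕ) : CompactSpace (OGroup n) := by
  refine isCompact_iff_compactSpace.mp ?_
  have hK : IsCompact (Set.univ.pi fun _ : Fin n => Set.univ.pi fun _ : Fin n =>
      Set.Icc (-1 : ℝ) 1) :=
    isCompact_univ_pi fun _ => isCompact_univ_pi fun _ => isCompact_Icc
  refine IsCompact.of_isClosed_subset
    (s := (Set.univ.pi fun _ : Fin n => Set.univ.pi fun _ : Fin n => Set.Icc (-1 : ℝ) 1)) hK ?_ ?_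
  · have h : ((Matrix.orthogonalGroup (Fin n) ℝ : Set (Matrix (Fin n) (Fin n) ℝ))) =
        {A | A * A.transpose = 1} := by
      ext A
      exact Matrix.mem_orthogonalGroup_iff (Fin n) ℝ
    rw [h]
    exact isClosed_eq (continuous_id.matrix_mul continuous_id.matrix_transpose) continuous_const
  · intro A hA i _ j _
    have := entry_norm_bound_of_unitary hA i j
    rw [Real.norm_eq_abs] at this
    exact abs_le.mp this

/-- `Haar(n)`: the Haar probability measure on the orthogonal group `𝕆(n)`. -/
def haarO (n : ℕ) : Measure (OGroup n) := Measure.haarMeasure ⊤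

/-- `Ginibre(n, 1)`: the law of a vector with `n` i.i.d. standard normal entries. -/
def ginibreVec (n : ℕ) : Measure (Vec n) := Measure.pi fun _ => gaussianReal 0 1

/-- The sign convention for Householder reflectors: `1` on `[0, ∞)` and `-1` on `(-∞, 0)`. -/
def sgn (a : ℝ) : ℝ := if 0 ≤ a then 1 else -1

/-- The Householder reflector `H(v) = -sgn(v₁) (I - 2 u uᵀ / (uᵀ u))` with
`u = v + sgn(v₁) ‖v‖ e₁`, where `‖·‖` is the Euclidean norm. The coordinates are indexed by an
arbitrary finite type `ι`, and `first : ι` is the coordinate that plays the role of `1`.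
By convention `H(0) = I`. -/
def householder {ι : Type} [Fintype ι] [DecidableEq ι] (first : ι) (v : ι → ℝ) : Matrix ι ι ℝ :=
  if v = 0 then 1
  else
    let u : ι → ℝ := v + (sgn (v first) * ‖WithLp.toLp 2 v‖) • Pi.single first 1
    (-sgn (v first)) • (1 - (2 / (u ⬝ᵥ u)) • Matrix.vecMulVec u u)

/-- The generalized Householder reflector `H_k(p) = diag(I_{k-1}, H(p[k:n]))` for `1 ≤ k ≤ n`.
Coordinates `1, …, n` are written `0, …, n - 1` in `Fin n`, so `p[k:n]` is the restriction of
`p` to the indices `≥ k - 1`. For `k` outside `{1, …, n}` (never used) the value is `I_n`. -/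
def genHouseholder {n : ℕ} (k : ℕ) (p : Vec n) : Matrix (Fin n) (Fin n) ℝ :=
  if h : 1 ≤ k ∧ k ≤ n then
    let first : Fin n := ⟨k - 1, by omega⟩
    Matrix.reindex (Equiv.sumCompl fun i : Fin n => i < first)
      (Equiv.sumCompl fun i : Fin n => i < first)
      (Matrix.fromBlocks 1 0 0
        (householder (⟨first, lt_irrefl first⟩ : {i : Fin n // ¬ i < first}) fun i => p i))
  else 1

/-- `A₀ A₁ ⋯ A_t`. -/
def prodAsc {n : ℕ} (A : ℕ → Matrix (Fin n) (Fin n) ℝ) : ℕ → Matrix (Fin n) (Fin n) ℝ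
  | 0 => A 0
  | t + 1 => prodAsc A t * A (t + 1)

/-- `A_t ⋯ A₁ A₀`. -/
def prodDesc {n : ℕ} (A : ℕ → Matrix (Fin n) (Fin n) ℝ) : ℕ → Matrix (Fin n) (Fin n) ℝ
  | 0 => A 0
  | t + 1 => A (t + 1) * prodDesc A t

/-- Which of the two matrices `Q`, `Qᵀ` is used in an iteration. -/
inductive Side : Type
  | direct : Side
  | transpose : Side

/-- The matrix `M_t`: either `Q` or `Qᵀ`. -/
def Side.apply {n : ℕ} (s : Side) (Q : Matrix (Fin n) (Fin n) ℝ) : Matrix (Fin n) (Fin n) ℝ :=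
  match s with
  | .direct => Q
  | .transpose => Q.transpose

/-- An initial condition `(x_t)_{1-d ≤ t ≤ 1}`. -/
abbrev InitCond (n d : ℕ) : Type := Set.Icc (1 - (d : ℤ)) 1 → Vec n

/-- The array `(x_t)_{t ∈ ℤ}` before the first iteration: it holds the initial condition, and zero
in the entries that are not yet (or never) filled. -/
def initArray {n d : ℕ} (x0 : InitCond n d) : ℤ → Vec n := fun t =>
  if h : t ∈ Set.Icc (1 - (d : ℤ)) 1 then x0 ⟨t, h⟩ else 0

/-- The history `(x_t, x_{t-1}, …, x_{t-d})`. -/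
def history {n : ℕ} (d : ℕ) (x : ℤ → Vec n) (t : ℤ) : Fin (d + 1) → Vec n := fun i => x (t - i)

/-- The direct simulation of `x_{t+1} = f_t(M_t x_t, x_t, x_{t-1}, …, x_{t-d})`, `t = 1, 2, …`, with
a given matrix `Q`: the array after the given number of iterations. -/
def directRun {n d : ℕ} (side : ℕ → Side) (f : ℕ → Vec n → (Fin (d + 1) → Vec n) → Vec n)
    (x0 : InitCond n d) (Q : Matrix (Fin n) (Fin n) ℝ) : ℕ → ℤ → Vec n
  | 0 => initArray x0
  | s + 1 =>
    let x := directRun side f x0 Q s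
    let t := s + 1
    Function.update x ((t : ℤ) + 1)
      (f t (((side t).apply Q).mulVec (x t)) (history d x t))

/-- The variables of the Householder Dice algorithm: the array of iterates and the reflectors. -/
structure HDState (n : ℕ) : Type where
  x : ℤ → Vec n
  L : ℕ → Matrix (Fin n) (Fin n) ℝ
  R : ℕ → Matrix (Fin n) (Fin n) ℝ

/-- Iteration `t ≥ 1` of the Householder Dice algorithm, with Gaussian vector `g = g_t`. -/
def hdStep {n d : ℕ} (side : ℕ → Side) (f : ℕ → Vec n → (Fin (d + 1) → Vec n) → Vec n)
    (t : ℕ) (g : Vec n) (s : HDState n) : HDState n :=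
  match side t with
  | .direct =>
    let p := (prodDesc s.R (t - 1)).mulVec (s.x t)
    let R := Function.update s.R t (genHouseholder t p)
    let L := Function.update s.L t (genHouseholder t g)
    let y := (prodAsc L t).mulVec ((R t).mulVec p)
    ⟨Function.update s.x ((t : ℤ) + 1) (f t y (history d s.x t)), L, R⟩
  | .transpose =>
    let p := (prodDesc s.L (t - 1)).mulVec (s.x t)
    let L := Function.update s.L t (genHouseholder t p)
    let R := Function.update s.R t (genHouseholder t g)
    let y := (prodAsc R t).mulVec ((L t).mulVec p)
    ⟨Function.update s.x ((t : ℤ) + 1) (f t y (history d s.x t)), L, R⟩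

/-- The Householder Dice algorithm, started from `L₀ = R₀ = I` (the other reflectors are not yet
filled; they are overwritten before they are read) and fed with the Gaussian vectors
`g₁, g₂, …`: the state after the given number of iterations. -/
def hdRun {n d : ℕ} (side : ℕ → Side) (f : ℕ → Vec n → (Fin (d + 1) → Vec n) → Vec n)
    (x0 : InitCond n d) (g : ℕ → Vec n) : ℕ → HDState n
  | 0 => ⟨initArray x0, fun _ => 1, fun _ => 1⟩
  | s + 1 => hdStep side f (s + 1) (g (s + 1)) (hdRun side f x0 g s)

/-- The family `(x_t)_{1-d ≤ t ≤ T+1}` read off an array. -/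
def iterates {n : ℕ} (d T : ℕ) (x : ℤ → Vec n) : Set.Icc (1 - (d : ℤ)) ((T : ℤ) + 1) → Vec n :=
  fun t => x t

end

end HouseholderDice

/-! The algorithm reveals a Haar matrix only as far as the iterates require. Let G_k be the group of
orthogonal matrices fixing the first k basis vectors (`fixOrth n k`). Complete the run by an
invariant random V in G_T, independent of the rest, and put Q = L_0 ⋯ L_T V R_T ⋯ R_0 (`hdMatrix`).
Two facts suffice.

Pathwise, the direct simulation with this Q returns the iterates of the algorithm, whatever V is
(`directRun_hdMatrix`). The reflectors of later iterations lie in G_t, so Q = L_0 ⋯ L_t E R_t ⋯ R_0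
with E in G_t. The reflected vector R_t p_t is supported on the first t coordinates, hence E does
not move it; transposed iterations are symmetric.

In law, Q is Haar for every fixed initial condition (`lintegral_hdMatrix`). If V is invariant on G_t
and g is an independent Gaussian vector, then H_t(g) V is invariant on G_{t-1}
(`IsFixHaar.genHouseholder_mul`). Given the past, the other reflector H_t(p_t) is a constant element
of G_{t-1}, absorbed by invariance on the other side. Removing iterations from T down to 0 leaves an
invariant element of G_0, the whole group. Fubini then treats a random initial condition. -/

namespace HouseholderDice

noncomputable section

open Matrix

/-! ### Householder reflectors -/

section Reflector

variable {ι : Type} [Fintype ι] [DecidableEq ι]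

lemma sgn_mul_self (a : ℝ) : sgn a * sgn a = 1 := by
  unfold sgn; split_ifs <;> norm_num

lemma sgn_mul_nonneg (a : ℝ) : 0 ≤ sgn a * a := by
  unfold sgn; split_ifs with h
  · simpa using h
  · push Not at h; linarith

lemma norm_toLp_mul_self {ι : Type} [Fintype ι] (v : ι → ℝ) :
    ‖WithLp.toLp 2 v‖ * ‖WithLp.toLp 2 v‖ = v ⬝ᵥ v := by
  rw [← sq, EuclideanSpace.real_norm_sq_eq]
  simp [dotProduct, sq]

lemma householder_zero (first : ι) : householder first (0 : ι → ℝ) = 1 := by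
  simp [householder]

lemma householder_transpose (first : ι) (v : ι → ℝ) :
    (householder first v)ᵀ = householder first v := by
  unfold householder
  split_ifs
  · simp
  · simp [transpose_vecMulVec]

lemma householder_mul_self (first : ι) (v : ι → ℝ) :
    householder first v * householder first v = 1 := by
  by_cases hv : v = 0
  · simp [hv, householder_zero]
  set u : ι → ℝ := v + (sgn (v first) * ‖WithLp.toLp 2 v‖) • Pi.single first 1 with hu
  have hH : householder first v =
      (-sgn (v first)) • (1 - (2 / (u ⬝ᵥ u)) • vecMulVec u u) := by
    simp only [householder, if_neg hv, ← hu]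
  have hs : (-sgn (v first)) * (-sgn (v first)) = 1 := by
    rw [neg_mul_neg, sgn_mul_self]
  have key : ((2 / (u ⬝ᵥ u)) • vecMulVec u u) * ((2 / (u ⬝ᵥ u)) • vecMulVec u u) =
      (2 : ℝ) • ((2 / (u ⬝ᵥ u)) • vecMulVec u u) := by
    rw [smul_mul_smul_comm, vecMulVec_mul_vecMulVec, vecMulVec_smul, smul_smul, smul_smul]
    congr 1
    -- Division by zero yields 0, so the degenerate case is trivial and u ≠ 0 is not needed here.
    by_cases h0 : u ⬝ᵥ u = 0
    · simp [h0]
    · field_simp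
  rw [hH, smul_mul_smul_comm, hs, one_smul, sub_mul, mul_sub, mul_sub, key]
  simp only [one_mul, mul_one, two_smul]
  abel

/-- Since u·u = 2 u·v, reflecting v across the hyperplane orthogonal to u gives v - u = -s‖v‖e₁; the
prefactor -s makes the coefficient positive. -/
lemma householder_mulVec_self (first : ι) (v : ι → ℝ) :
    householder first v *ᵥ v = ‖WithLp.toLp 2 v‖ • Pi.single first 1 := by
  by_cases hv : v = 0
  · simp [hv]
  set r := ‖WithLp.toLp 2 v‖ with hr
  have hr0 : 0 < r := by
    rw [hr, norm_pos_iff]; simpa using hv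
  set s := sgn (v first) with hs
  set u : ι → ℝ := v + (s * r) • Pi.single first 1 with hu
  have hH : householder first v = (-s) • (1 - (2 / (u ⬝ᵥ u)) • vecMulVec u u) := by
    simp only [householder, if_neg hv, ← hu, ← hr, ← hs]
  have hss : s * s = 1 := sgn_mul_self _
  have hrr : v ⬝ᵥ v = r * r := (norm_toLp_mul_self v).symm
  have huv : u ⬝ᵥ v = r * r + s * r * v first := by
    rw [hu, add_dotProduct, smul_dotProduct, hrr]; simp
  have huu : u ⬝ᵥ u = 2 * (u ⬝ᵥ v) := by
    have : u ⬝ᵥ u = u ⬝ᵥ v + s * r * u first := by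
      conv_lhs => rw [hu]
      rw [← hu, dotProduct_add, dotProduct_smul]; simp
    rw [this, huv, hu]
    simp only [Pi.add_apply, Pi.smul_apply, Pi.single_eq_same, smul_eq_mul, mul_one]
    linear_combination r * r * hss
  -- The sign convention enters here: s v₁ = |v₁| prevents cancellation in ‖v‖² + ‖v‖ s v₁.
  have hpos : 0 < u ⬝ᵥ v := by
    have := sgn_mul_nonneg (v first)
    rw [← hs] at this
    rw [huv]; nlinarith [mul_nonneg hr0.le this]
  rw [hH, smul_mulVec, sub_mulVec, one_mulVec, smul_mulVec, vecMulVec_mulVec, huu]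
  have : (2 / (2 * (u ⬝ᵥ v))) * (u ⬝ᵥ v) = 1 := by field_simp
  ext i
  simp only [op_smul_eq_smul, smul_smul, this, one_smul]
  simp only [hu, Pi.smul_apply, Pi.sub_apply, Pi.add_apply, smul_eq_mul]
  linear_combination r * (Pi.single first 1 : ι → ℝ) i * hss

lemma householder_mulVec_single (first : ι) {v : ι → ℝ} (hv : v ≠ 0) :
    householder first v *ᵥ Pi.single first 1 = ‖WithLp.toLp 2 v‖⁻¹ • v := by
  have hr0 : ‖WithLp.toLp 2 v‖ ≠ 0 := by simpa using hv
  have h := congrArg (fun w => householder first v *ᵥ w) (householder_mulVec_self first v)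
  simp only [mulVec_mulVec, householder_mul_self, one_mulVec, mulVec_smul] at h
  rw [eq_inv_smul_iff₀ hr0, ← h]

end Reflector

/-! ### Stabilizers of the first basis vectors -/

section Fix

variable {n : ℕ}

/-- The orthogonal matrices that fix the first `k` standard basis vectors. -/
def fixOrth (n k : ℕ) : Submonoid (Matrix (Fin n) (Fin n) ℝ) where
  carrier := {A | A * Aᵀ = 1 ∧ ∀ j : Fin n, (j : ℕ) < k → A *ᵥ Pi.single j 1 = Pi.single j 1}
  one_mem' := ⟨by simp, fun j _ => one_mulVec _⟩
  mul_mem' := by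
    rintro A B ⟨hA, hA'⟩ ⟨hB, hB'⟩
    refine ⟨?_, fun j hj => ?_⟩
    · rw [transpose_mul, mul_assoc, ← mul_assoc B, hB, one_mul, hA]
    · rw [← mulVec_mulVec, hB' j hj, hA' j hj]

lemma mem_fixOrth {k : ℕ} {A : Matrix (Fin n) (Fin n) ℝ} : A ∈ fixOrth n k ↔
    A * Aᵀ = 1 ∧ ∀ j : Fin n, (j : ℕ) < k → A *ᵥ Pi.single j 1 = Pi.single j 1 := Iff.rfl

lemma fixOrth_anti {k l : ℕ} (h : k ≤ l) : fixOrth n l ≤ fixOrth n k :=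
  fun _ hA => ⟨hA.1, fun j hj => hA.2 j (hj.trans_le h)⟩

lemma transpose_mul_of_mem_fixOrth {k : ℕ} {A : Matrix (Fin n) (Fin n) ℝ}
    (hA : A ∈ fixOrth n k) : Aᵀ * A = 1 := mul_eq_one_comm.mp hA.1

lemma transpose_mem_fixOrth {k : ℕ} {A : Matrix (Fin n) (Fin n) ℝ}
    (hA : A ∈ fixOrth n k) : Aᵀ ∈ fixOrth n k := by
  refine ⟨?_, fun j hj => ?_⟩
  · rw [transpose_transpose, transpose_mul_of_mem_fixOrth hA]
  · conv_lhs => rw [← hA.2 j hj]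
    rw [mulVec_mulVec, transpose_mul_of_mem_fixOrth hA, one_mulVec]

lemma mem_fixOrth_zero_iff {A : Matrix (Fin n) (Fin n) ℝ} :
    A ∈ fixOrth n 0 ↔ A ∈ Matrix.orthogonalGroup (Fin n) ℝ := by
  rw [Matrix.mem_orthogonalGroup_iff, mem_fixOrth]
  simp

lemma eq_one_of_mem_fixOrth_self {A : Matrix (Fin n) (Fin n) ℝ} (hA : A ∈ fixOrth n n) :
    A = 1 := by
  refine Matrix.ext_of_mulVec_single fun j => ?_
  rw [hA.2 j j.2, one_mulVec]

/-- A matrix of `fixOrth n k` fixes every vector supported on the first `k` coordinates. -/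
lemma mulVec_eq_self_of_mem_fixOrth {k : ℕ} {A : Matrix (Fin n) (Fin n) ℝ}
    (hA : A ∈ fixOrth n k) {w : Vec n} (hw : ∀ i : Fin n, k ≤ (i : ℕ) → w i = 0) :
    A *ᵥ w = w := by
  have hsum : w = ∑ j, w j • (Pi.single j 1 : Vec n) := by
    ext i
    simp [Finset.sum_apply, Pi.single_apply]
  conv_lhs => rw [hsum]
  conv_rhs => rw [hsum]
  rw [mulVec_sum]
  refine Finset.sum_congr rfl fun j _ => ?_
  rw [mulVec_smul]
  by_cases hj : (j : ℕ) < k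
  · rw [hA.2 j hj]
  · rw [hw j (not_lt.mp hj), zero_smul, zero_smul]

/-- Coordinate i of A w is the inner product of w with Aᵀ e_i, and Aᵀ also fixes e_i. -/
lemma apply_mulVec_of_mem_fixOrth {k : ℕ} {A : Matrix (Fin n) (Fin n) ℝ}
    (hA : A ∈ fixOrth n k) (w : Vec n) {i : Fin n} (hi : (i : ℕ) < k) : (A *ᵥ w) i = w i := by
  have h : (A *ᵥ w) ⬝ᵥ Pi.single i 1 = w ⬝ᵥ (Aᵀ *ᵥ Pi.single i 1) := by
    rw [dotProduct_comm, dotProduct_mulVec, dotProduct_comm, mulVec_transpose]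
  rw [(transpose_mem_fixOrth hA).2 i hi] at h
  simpa using h

/-! ### Generalized reflectors -/

/-- Set to zero the first `k` coordinates. -/
def tailVec (k : ℕ) (w : Vec n) : Vec n := fun i => if (i : ℕ) < k then 0 else w i

lemma genHouseholder_transpose (k : ℕ) (p : Vec n) :
    (genHouseholder k p)ᵀ = genHouseholder k p := by
  unfold genHouseholder
  split_ifs
  · simp only [reindex_apply, transpose_submatrix, fromBlocks_transpose, transpose_one,
      transpose_zero, householder_transpose]
  · simp

lemma genHouseholder_mul_self (k : ℕ) (p : Vec n) :
    genHouseholder k p * genHouseholder k p = 1 := by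
  unfold genHouseholder
  split_ifs
  · simp only [reindex_apply]
    rw [submatrix_mul_equiv, fromBlocks_multiply]
    simp [householder_mul_self]
  · simp

lemma genHouseholder_mulVec_of_lt {k : ℕ} (hk1 : 1 ≤ k) (hkn : k ≤ n) (p w : Vec n) {i : Fin n}
    (hi : (i : ℕ) < k - 1) : (genHouseholder k p *ᵥ w) i = w i := by
  have hi' : i < (⟨k - 1, by omega⟩ : Fin n) := hi
  unfold genHouseholder
  rw [dif_pos ⟨hk1, hkn⟩]
  simp only [reindex_apply]
  rw [submatrix_mulVec_equiv, Function.comp_apply, Equiv.sumCompl_symm_apply_of_pos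
    (p := fun i : Fin n => i < ⟨k - 1, by omega⟩) hi',
    fromBlocks_mulVec]
  simp

lemma genHouseholder_mulVec_of_ge {k : ℕ} (hk1 : 1 ≤ k) (hkn : k ≤ n) (p w : Vec n) {i : Fin n}
    (hi : ¬ i < (⟨k - 1, by omega⟩ : Fin n)) : (genHouseholder k p *ᵥ w) i =
      (householder (⟨⟨k - 1, by omega⟩, lt_irrefl _⟩ : {i : Fin n // ¬ i < ⟨k - 1, by omega⟩})
        (fun i => p i) *ᵥ fun i => w i) ⟨i, hi⟩ := by
  unfold genHouseholder
  rw [dif_pos ⟨hk1, hkn⟩]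
  simp only [reindex_apply]
  rw [submatrix_mulVec_equiv, Function.comp_apply, Equiv.sumCompl_symm_apply_of_neg
    (p := fun i : Fin n => i < ⟨k - 1, by omega⟩) hi,
    fromBlocks_mulVec]
  simp only [Sum.elim_inr, zero_mulVec, zero_add]
  rfl

lemma genHouseholder_mem_fixOrth {k : ℕ} (hk1 : 1 ≤ k) (hkn : k ≤ n) (p : Vec n) :
    genHouseholder k p ∈ fixOrth n (k - 1) := by
  refine ⟨by rw [genHouseholder_transpose, genHouseholder_mul_self], fun j hj => ?_⟩
  ext i
  by_cases hi : i < (⟨k - 1, by omega⟩ : Fin n)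
  · rw [genHouseholder_mulVec_of_lt hk1 hkn p _ hi]
  · rw [genHouseholder_mulVec_of_ge hk1 hkn p _ hi]
    have : (fun i : {i : Fin n // ¬ i < ⟨k - 1, by omega⟩} =>
        (Pi.single j 1 : Vec n) i) = 0 := by
      ext ⟨l, hl⟩
      have : l ≠ j := by rintro rfl; exact hl hj
      simp [this]
    rw [this, mulVec_zero]
    have : i ≠ j := by rintro rfl; exact hi hj
    simp [this]

/-- `H_k(p) p` is supported on the first `k` coordinates. -/
lemma genHouseholder_mulVec_self_apply {k : ℕ} (hk1 : 1 ≤ k) (hkn : k ≤ n) (p : Vec n)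
    {i : Fin n} (hi : k ≤ (i : ℕ)) : (genHouseholder k p *ᵥ p) i = 0 := by
  have hi' : ¬ i < (⟨k - 1, by omega⟩ : Fin n) := by
    simp only [Fin.lt_def]; omega
  rw [genHouseholder_mulVec_of_ge hk1 hkn p _ hi', householder_mulVec_self]
  have : (⟨i, hi'⟩ : {i : Fin n // ¬ i < ⟨k - 1, by omega⟩}) ≠ ⟨⟨k - 1, by omega⟩, lt_irrefl _⟩ := by
    simp only [ne_eq, Subtype.mk.injEq, Fin.ext_iff]; omega
  simp [this]

lemma norm_tail_subtype {k : ℕ} (hk1 : 1 ≤ k) (hkn : k ≤ n) (p : Vec n) :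
    ‖WithLp.toLp 2 (fun i : {i : Fin n // ¬ i < ⟨k - 1, by omega⟩} => p i)‖ =
      ‖WithLp.toLp 2 (tailVec (k - 1) p)‖ := by
  rw [← sq_eq_sq₀ (norm_nonneg _) (norm_nonneg _), EuclideanSpace.real_norm_sq_eq,
    EuclideanSpace.real_norm_sq_eq]
  have : ∀ i : Fin n, (tailVec (k - 1) p i) ^ 2 =
      if ¬ i < (⟨k - 1, by omega⟩ : Fin n) then p i ^ 2 else 0 := by
    intro i
    simp only [tailVec, Fin.lt_def]
    split_ifs <;> simp_all
  simp only [this]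
  rw [← Finset.sum_filter]
  exact (Finset.sum_subtype (Finset.univ.filter fun i : Fin n => ¬ i < ⟨k - 1, by omega⟩)
    (by simp) (fun i => p i ^ 2)).symm

/-- `H_k(p)` sends the `k`-th basis vector to the direction of the tail of `p`. -/
lemma genHouseholder_mulVec_single {k : ℕ} (hk1 : 1 ≤ k) (hkn : k ≤ n) {p : Vec n}
    (hp : tailVec (k - 1) p ≠ 0) :
    genHouseholder k p *ᵥ Pi.single (⟨k - 1, by omega⟩ : Fin n) 1 =
      ‖WithLp.toLp 2 (tailVec (k - 1) p)‖⁻¹ • tailVec (k - 1) p := by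
  ext i
  by_cases hi : i < (⟨k - 1, by omega⟩ : Fin n)
  · rw [genHouseholder_mulVec_of_lt hk1 hkn p _ hi]
    have : (i : ℕ) < k - 1 := hi
    simp [hi.ne, tailVec, this]
  · have hi' : ¬ (i : ℕ) < k - 1 := hi
    have hp' : (fun i : {i : Fin n // ¬ i < ⟨k - 1, by omega⟩} => p i) ≠ 0 := by
      intro h0
      refine hp ?_
      ext j
      simp only [tailVec]
      split_ifs with hj
      · rfl
      · exact congrFun h0 ⟨j, hj⟩
    have hsing : (fun i : {i : Fin n // ¬ i < ⟨k - 1, by omega⟩} =>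
        (Pi.single (⟨k - 1, by omega⟩ : Fin n) 1 : Vec n) i) =
        Pi.single ⟨⟨k - 1, by omega⟩, lt_irrefl _⟩ 1 := by
      ext ⟨l, hl⟩
      simp [Pi.single_apply]
    rw [genHouseholder_mulVec_of_ge hk1 hkn p _ hi, hsing, householder_mulVec_single _ hp',
      norm_tail_subtype hk1 hkn]
    simp [tailVec, hi']

/-- The group preserves the splitting into the first k coordinates, on which it is trivial, and
their orthogonal complement. -/
lemma tailVec_mulVec {k : ℕ} {A : Matrix (Fin n) (Fin n) ℝ} (hA : A ∈ fixOrth n k) (w : Vec n) :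
    tailVec k (A *ᵥ w) = A *ᵥ tailVec k w := by
  have hw : w = tailVec k w + (w - tailVec k w) := by abel
  have h : A *ᵥ (w - tailVec k w) = w - tailVec k w :=
    mulVec_eq_self_of_mem_fixOrth hA fun i hi => by simp [tailVec, not_lt.mpr hi]
  ext i
  by_cases hi : (i : ℕ) < k
  · rw [apply_mulVec_of_mem_fixOrth hA _ hi]; simp [tailVec, hi]
  · simp only [tailVec, if_neg hi]
    conv_lhs => rw [hw]
    rw [mulVec_add, h]
    simp [tailVec, hi]

lemma norm_mulVec_of_mem_fixOrth {k : ℕ} {A : Matrix (Fin n) (Fin n) ℝ} (hA : A ∈ fixOrth n k)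
    (w : Vec n) : ‖WithLp.toLp 2 (A *ᵥ w)‖ = ‖WithLp.toLp 2 w‖ := by
  rw [← mul_self_inj (norm_nonneg _) (norm_nonneg _), norm_toLp_mul_self, norm_toLp_mul_self,
    dotProduct_mulVec, ← mulVec_transpose, mulVec_mulVec, transpose_mul_of_mem_fixOrth hA,
    one_mulVec]

/-- Left multiplication by `A` moves `H_k(p)` to `H_k(A p)`, up to a right factor that fixes one
more basis vector. -/
lemma genHouseholder_mul_mul_mem_fixOrth {k : ℕ} (hk1 : 1 ≤ k) (hkn : k ≤ n)
    {A : Matrix (Fin n) (Fin n) ℝ} (hA : A ∈ fixOrth n (k - 1)) {p : Vec n}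
    (hp : tailVec (k - 1) p ≠ 0) :
    genHouseholder k (A *ᵥ p) * (A * genHouseholder k p) ∈ fixOrth n k := by
  have hmem : genHouseholder k (A *ᵥ p) * (A * genHouseholder k p) ∈ fixOrth n (k - 1) :=
    mul_mem (genHouseholder_mem_fixOrth hk1 hkn _) (mul_mem hA (genHouseholder_mem_fixOrth hk1 hkn _))
  refine ⟨hmem.1, fun j hj => ?_⟩
  rcases lt_or_ge (j : ℕ) (k - 1) with h | h
  · exact hmem.2 j h
  have hlt : k - 1 < n := by omega
  obtain rfl : j = ⟨k - 1, hlt⟩ := Fin.ext (by simp; omega)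
  have hAp : tailVec (k - 1) (A *ᵥ p) ≠ 0 := by
    rw [tailVec_mulVec hA]
    intro h0
    refine hp ?_
    have := congrArg (fun w => Aᵀ *ᵥ w) h0
    simpa [mulVec_mulVec, transpose_mul_of_mem_fixOrth hA] using this
  -- Both sides are the unit direction of the tail of A p, because A commutes with taking tails and
  -- preserves norms.
  have key : A *ᵥ genHouseholder k p *ᵥ Pi.single (⟨k - 1, by omega⟩ : Fin n) 1 =
      genHouseholder k (A *ᵥ p) *ᵥ Pi.single (⟨k - 1, by omega⟩ : Fin n) 1 := by
    rw [genHouseholder_mulVec_single hk1 hkn hp, genHouseholder_mulVec_single hk1 hkn hAp,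
      tailVec_mulVec hA, norm_mulVec_of_mem_fixOrth hA, mulVec_smul]
  rw [← mulVec_mulVec, ← mulVec_mulVec, key, mulVec_mulVec, genHouseholder_mul_self, one_mulVec]

end Fix

section

variable {n : ℕ}

/-! ### Measurability of matrix-valued maps -/

instance instMeasurableSpaceMatrix (n : ℕ) : MeasurableSpace (Matrix (Fin n) (Fin n) ℝ) :=
  inferInstanceAs (MeasurableSpace (Fin n → Fin n → ℝ))

instance instBorelSpaceMatrix (n : ℕ) : BorelSpace (Matrix (Fin n) (Fin n) ℝ) :=
  inferInstanceAs (BorelSpace (Fin n → Fin n → ℝ))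

section Measurability

variable {α : Type*} [MeasurableSpace α]

lemma measurable_matrix_of_entries {F : α → Matrix (Fin n) (Fin n) ℝ}
    (h : ∀ i j, Measurable fun a => F a i j) : Measurable F :=
  measurable_pi_iff.mpr fun i => measurable_pi_iff.mpr fun j => h i j

lemma measurable_matrix_entry {F : α → Matrix (Fin n) (Fin n) ℝ} (hF : Measurable F)
    (i j : Fin n) : Measurable fun a => F a i j :=
  measurable_pi_iff.mp (measurable_pi_iff.mp hF i) j

lemma measurable_matrix_mul {F G : α → Matrix (Fin n) (Fin n) ℝ} (hF : Measurable F)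
    (hG : Measurable G) : Measurable fun a => F a * G a := by
  refine measurable_matrix_of_entries fun i j => ?_
  simp only [Matrix.mul_apply]
  exact Finset.measurable_sum _ fun l _ =>
    (measurable_matrix_entry hF i l).mul (measurable_matrix_entry hG l j)

lemma measurable_matrix_mulVec {F : α → Matrix (Fin n) (Fin n) ℝ} {w : α → Vec n}
    (hF : Measurable F) (hw : Measurable w) : Measurable fun a => F a *ᵥ w a := by
  refine measurable_pi_iff.mpr fun i => ?_
  simp only [mulVec, dotProduct]
  exact Finset.measurable_sum _ fun l _ =>
    (measurable_matrix_entry hF i l).mul (measurable_pi_iff.mp hw l)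

lemma measurable_matrix_transpose {F : α → Matrix (Fin n) (Fin n) ℝ} (hF : Measurable F) :
    Measurable fun a => (F a)ᵀ :=
  measurable_matrix_of_entries fun i j => measurable_matrix_entry hF j i

lemma measurable_sgn : Measurable sgn :=
  Measurable.ite measurableSet_Ici measurable_const measurable_const

lemma measurable_householder_entry {ι : Type} [Fintype ι] [DecidableEq ι] (first i j : ι) :
    Measurable fun v : ι → ℝ => householder first v i j := by
  have hnorm : Measurable fun v : ι → ℝ => ‖WithLp.toLp 2 v‖ :=
    (PiLp.continuous_toLp 2 fun _ : ι => ℝ).norm.measurable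
  have hs : Measurable fun v : ι → ℝ => sgn (v first) := measurable_sgn.comp (measurable_pi_apply _)
  have hu : ∀ l, Measurable fun v : ι → ℝ =>
      (v + (sgn (v first) * ‖WithLp.toLp 2 v‖) • (Pi.single first 1 : ι → ℝ)) l := fun l => by
    simp only [Pi.add_apply, Pi.smul_apply, smul_eq_mul]
    exact (measurable_pi_apply l).add ((hs.mul hnorm).mul measurable_const)
  have : ∀ v : ι → ℝ, householder first v i j = if v = 0 then (1 : Matrix ι ι ℝ) i j else
      ((-sgn (v first)) • ((1 : Matrix ι ι ℝ) - (2 /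
        ((v + (sgn (v first) * ‖WithLp.toLp 2 v‖) • (Pi.single first 1 : ι → ℝ)) ⬝ᵥ
          (v + (sgn (v first) * ‖WithLp.toLp 2 v‖) • (Pi.single first 1 : ι → ℝ)))) •
        vecMulVec (v + (sgn (v first) * ‖WithLp.toLp 2 v‖) • (Pi.single first 1 : ι → ℝ))
          (v + (sgn (v first) * ‖WithLp.toLp 2 v‖) • (Pi.single first 1 : ι → ℝ))) :
            Matrix ι ι ℝ) i j := by
    intro v
    unfold householder
    split_ifs <;> rfl
  simp only [this]
  refine Measurable.ite (measurableSet_singleton 0) measurable_const ?_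
  simp only [Matrix.smul_apply, Matrix.sub_apply, vecMulVec_apply, smul_eq_mul, dotProduct]
  refine hs.neg.mul (measurable_const.sub ?_)
  refine Measurable.mul ?_ ((hu i).mul (hu j))
  exact measurable_const.div (Finset.measurable_sum _ fun l _ => (hu l).mul (hu l))

lemma measurable_genHouseholder (k : ℕ) :
    Measurable (genHouseholder k : Vec n → Matrix (Fin n) (Fin n) ℝ) := by
  refine measurable_matrix_of_entries fun i j => ?_
  unfold genHouseholder
  by_cases h : 1 ≤ k ∧ k ≤ n
  · simp only [dif_pos h, reindex_apply, submatrix_apply]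
    rcases (Equiv.sumCompl fun i : Fin n => i < ⟨k - 1, by omega⟩).symm i with a | a <;>
    rcases (Equiv.sumCompl fun i : Fin n => i < ⟨k - 1, by omega⟩).symm j with b | b
    · simp only [fromBlocks_apply₁₁]; exact measurable_const
    · simp only [fromBlocks_apply₁₂]; exact measurable_const
    · simp only [fromBlocks_apply₂₁]; exact measurable_const
    · simp only [fromBlocks_apply₂₂]
      exact (measurable_householder_entry _ a b).comp
        (measurable_pi_iff.mpr fun i => measurable_pi_apply _)
  · simp only [dif_neg h]; exact measurable_const

lemma measurableSet_fixOrth (n k : ℕ) :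
    MeasurableSet {A | A ∈ fixOrth n k} := by
  have : {A | A ∈ fixOrth n k} =
      {A | A * Aᵀ = 1} ∩ ⋂ j : Fin n, {A | (j : ℕ) < k → A *ᵥ Pi.single j 1 = Pi.single j 1} := by
    ext A
    simp [mem_fixOrth]
  rw [this]
  refine MeasurableSet.inter ?_ (MeasurableSet.iInter fun j => ?_)
  · exact (isClosed_eq (continuous_id.matrix_mul continuous_id.matrix_transpose)
      continuous_const).measurableSet
  · by_cases hj : (j : ℕ) < k
    · simp only [hj, forall_const]
      exact (isClosed_eq (continuous_id.matrix_mulVec continuous_const)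
        continuous_const).measurableSet
    · simp [hj]

end Measurability

/-! ### Gaussian vectors -/

instance instIsProbabilityMeasureGinibreVec (n : ℕ) : IsProbabilityMeasure (ginibreVec n) := by
  unfold ginibreVec; infer_instance

/-- Rotation invariance of the Gaussian law, transported from the standard Gaussian on Euclidean
space, where A is a linear isometry. -/
lemma ginibreVec_map_mulVec {k : ℕ} {A : Matrix (Fin n) (Fin n) ℝ} (hA : A ∈ fixOrth n k) :
    (ginibreVec n).map (fun w => A *ᵥ w) = ginibreVec n := by
  let e : EuclideanSpace ℝ (Fin n) ≃ₗᵢ[ℝ] EuclideanSpace ℝ (Fin n) :=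
    LinearIsometry.toLinearIsometryEquiv
      ⟨Matrix.toEuclideanLin A, fun x => norm_mulVec_of_mem_fixOrth hA x.ofLp⟩ rfl
  have hA' : Measurable fun w : Vec n => A *ᵥ w :=
    measurable_matrix_mulVec measurable_const measurable_id
  have ht : Measurable (WithLp.toLp 2 : Vec n → EuclideanSpace ℝ (Fin n)) :=
    (PiLp.continuous_toLp 2 fun _ : Fin n => ℝ).measurable
  have ho : Measurable (WithLp.ofLp : EuclideanSpace ℝ (Fin n) → Vec n) :=
    (PiLp.continuous_ofLp 2 fun _ : Fin n => ℝ).measurable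
  have he : Measurable e := e.continuous.measurable
  have hstd : (ginibreVec n).map (WithLp.toLp 2) = stdGaussian (EuclideanSpace ℝ (Fin n)) :=
    map_pi_eq_stdGaussian
  have hback : ginibreVec n = (stdGaussian (EuclideanSpace ℝ (Fin n))).map WithLp.ofLp := by
    rw [← hstd, Measure.map_map ho ht]
    exact Measure.map_id.symm
  have hcomp : (fun w : Vec n => A *ᵥ w) ∘ WithLp.ofLp =
      WithLp.ofLp ∘ (e : EuclideanSpace ℝ (Fin n) → EuclideanSpace ℝ (Fin n)) := rfl
  conv_lhs => rw [hback]
  rw [Measure.map_map hA' ho, hcomp, ← Measure.map_map ho he, stdGaussian_map e, ← hback]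

/-- Coordinate k alone is an atomless normal variable. This discards the convention H(0) = I, for
which the direction formula fails. -/
lemma ae_tailVec_ne_zero {k : ℕ} (hk1 : 1 ≤ k) (hkn : k ≤ n) :
    ∀ᵐ w ∂ginibreVec n, tailVec (k - 1) w ≠ 0 := by
  have hlt : k - 1 < n := by omega
  have h0 : ∀ᵐ w ∂ginibreVec n, w ⟨k - 1, hlt⟩ ≠ 0 := by
    have hmp := measurePreserving_eval (fun _ : Fin n => gaussianReal 0 1) ⟨k - 1, hlt⟩
    refine hmp.quasiMeasurePreserving.ae (p := fun x : ℝ => x ≠ 0) ?_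
    have := nullSingletonClass_gaussianReal (μ := 0) (v := 1) one_ne_zero
    exact Measure.ae_ne _ 0
  filter_upwards [h0] with w hw h
  refine hw ?_
  have := congrFun h ⟨k - 1, hlt⟩
  simpa [tailVec] using this

/-! ### Invariant measures on `fixOrth` -/

lemma measurable_mul_left_matrix (A : Matrix (Fin n) (Fin n) ℝ) :
    Measurable fun B : Matrix (Fin n) (Fin n) ℝ => A * B :=
  measurable_matrix_mul measurable_const measurable_id

lemma measurable_mul_right_matrix (A : Matrix (Fin n) (Fin n) ℝ) :
    Measurable fun B : Matrix (Fin n) (Fin n) ℝ => B * A :=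
  measurable_matrix_mul measurable_id measurable_const

lemma measurable_transpose_matrix :
    Measurable fun B : Matrix (Fin n) (Fin n) ℝ => Bᵀ :=
  measurable_matrix_transpose measurable_id

/-- `μ` is a probability measure carried by `fixOrth n k` and invariant under left translations. -/
structure IsFixHaar (k : ℕ) (μ : Measure (Matrix (Fin n) (Fin n) ℝ)) : Prop where
  prob : IsProbabilityMeasure μ
  ae_mem : ∀ᵐ A ∂μ, A ∈ fixOrth n k
  map_mul_left : ∀ A ∈ fixOrth n k, μ.map (fun B => A * B) = μ

/-- For independent X ~ μ and Y ~ ν, the product X Y has law ν when X is fixed first and law μ when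
Y is fixed first. This gives both uniqueness and invariance under transposition. -/
lemma eq_of_right_left_invariant {k : ℕ} {μ ν : Measure (Matrix (Fin n) (Fin n) ℝ)}
    [IsProbabilityMeasure μ] (hμm : ∀ᵐ A ∂μ, A ∈ fixOrth n k)
    (hμ : ∀ A ∈ fixOrth n k, μ.map (fun B => B * A) = μ) (hν : IsFixHaar k ν) : μ = ν := by
  have := hν.prob
  refine Measure.ext_of_lintegral _ fun φ hφ => ?_
  have hm : Measurable (Function.uncurry fun X Y : Matrix (Fin n) (Fin n) ℝ => φ (X * Y)) :=
    hφ.comp (measurable_matrix_mul measurable_fst measurable_snd)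
  have h1 : ∫⁻ X, ∫⁻ Y, φ (X * Y) ∂ν ∂μ = ∫⁻ Y, φ Y ∂ν := by
    have : ∀ᵐ X ∂μ, ∫⁻ Y, φ (X * Y) ∂ν = ∫⁻ Y, φ Y ∂ν := by
      filter_upwards [hμm] with X hX
      conv_rhs => rw [← hν.map_mul_left X hX]
      rw [lintegral_map hφ (measurable_mul_left_matrix X)]
    rw [lintegral_congr_ae this]; simp
  have h2 : ∫⁻ Y, ∫⁻ X, φ (X * Y) ∂μ ∂ν = ∫⁻ X, φ X ∂μ := by
    have : ∀ᵐ Y ∂ν, ∫⁻ X, φ (X * Y) ∂μ = ∫⁻ X, φ X ∂μ := by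
      filter_upwards [hν.ae_mem] with Y hY
      conv_rhs => rw [← hμ Y hY]
      rw [lintegral_map hφ (measurable_mul_right_matrix Y)]
    rw [lintegral_congr_ae this]; simp
  rw [← h1, ← h2, lintegral_lintegral_swap hm.aemeasurable]

namespace IsFixHaar

variable {k : ℕ} {μ ν : Measure (Matrix (Fin n) (Fin n) ℝ)}

/-- Transposition is inversion on the group, so the image of a left-invariant measure is
right-invariant. -/
lemma map_transpose (hμ : IsFixHaar k μ) : μ.map (fun B => Bᵀ) = μ := by
  have := hμ.prob
  have := Measure.isProbabilityMeasure_map (μ := μ) measurable_transpose_matrix.aemeasurable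
  refine eq_of_right_left_invariant (k := k) ?_ (fun A hA => ?_) hμ
  · rw [ae_map_iff measurable_transpose_matrix.aemeasurable (measurableSet_fixOrth n k)]
    filter_upwards [hμ.ae_mem] with A hA using transpose_mem_fixOrth hA
  · rw [Measure.map_map (measurable_mul_right_matrix A) measurable_transpose_matrix]
    have : (fun B : Matrix (Fin n) (Fin n) ℝ => B * A) ∘ (fun B => Bᵀ) =
        (fun B => Bᵀ) ∘ fun B => Aᵀ * B := by
      ext1 B; simp
    rw [this, ← Measure.map_map measurable_transpose_matrix (measurable_mul_left_matrix _),
      hμ.map_mul_left _ (transpose_mem_fixOrth hA)]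

lemma map_mul_right (hμ : IsFixHaar k μ) {A : Matrix (Fin n) (Fin n) ℝ}
    (hA : A ∈ fixOrth n k) : μ.map (fun B => B * A) = μ := by
  have : (fun B : Matrix (Fin n) (Fin n) ℝ => B * A) =
      (fun B => Bᵀ) ∘ (fun B => Aᵀ * B) ∘ (fun B => Bᵀ) := by
    ext1 B; simp
  rw [this, ← Measure.map_map measurable_transpose_matrix
    ((measurable_mul_left_matrix _).comp measurable_transpose_matrix),
    ← Measure.map_map (measurable_mul_left_matrix _) measurable_transpose_matrix,
    hμ.map_transpose, hμ.map_mul_left _ (transpose_mem_fixOrth hA), hμ.map_transpose]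

protected lemma eq (hμ : IsFixHaar k μ) (hν : IsFixHaar k ν) : μ = ν :=
  have := hμ.prob
  eq_of_right_left_invariant hμ.ae_mem (fun _ hA => hμ.map_mul_right hA) hν

end IsFixHaar

lemma isFixHaar_dirac : IsFixHaar n (Measure.dirac (1 : Matrix (Fin n) (Fin n) ℝ)) where
  prob := inferInstance
  ae_mem := by
    rw [ae_dirac_iff (measurableSet_fixOrth n n)]
    exact one_mem _
  map_mul_left A hA := by
    rw [eq_one_of_mem_fixOrth_self hA]
    simp

lemma measurable_genHouseholder_mul (k : ℕ) :
    Measurable fun q : Vec n × Matrix (Fin n) (Fin n) ℝ => genHouseholder k q.1 * q.2 :=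
  measurable_matrix_mul ((measurable_genHouseholder k).comp measurable_fst) measurable_snd

/-- A Gaussian reflector times an invariant factor is invariant under the next larger group. -/
lemma IsFixHaar.genHouseholder_mul {k : ℕ} (hk1 : 1 ≤ k) (hkn : k ≤ n)
    {μ : Measure (Matrix (Fin n) (Fin n) ℝ)} (hμ : IsFixHaar k μ) :
    IsFixHaar (k - 1)
      (((ginibreVec n).prod μ).map fun q => genHouseholder k q.1 * q.2) := by
  have := hμ.prob
  have hm := measurable_genHouseholder_mul (n := n) k
  refine ⟨Measure.isProbabilityMeasure_map hm.aemeasurable, ?_, fun A hA => ?_⟩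
  · rw [ae_map_iff hm.aemeasurable (measurableSet_fixOrth n (k - 1))]
    refine (Measure.ae_prod_iff_ae_ae (hm (measurableSet_fixOrth n (k - 1)))).mpr ?_
    filter_upwards with w
    filter_upwards [hμ.ae_mem] with V hV
    exact mul_mem (genHouseholder_mem_fixOrth hk1 hkn w) (fixOrth_anti (Nat.sub_le k 1) hV)
  · refine Measure.ext_of_lintegral _ fun φ hφ => ?_
    have hφA : Measurable fun B => φ (A * B) := hφ.comp (measurable_mul_left_matrix A)
    have hφm : Measurable fun q : Vec n × Matrix (Fin n) (Fin n) ℝ =>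
      φ (genHouseholder k q.1 * q.2) := hφ.comp hm
    have hφAm : Measurable fun q : Vec n × Matrix (Fin n) (Fin n) ℝ =>
      φ (A * (genHouseholder k q.1 * q.2)) := hφA.comp hm
    rw [lintegral_map hφ (measurable_mul_left_matrix A), lintegral_map hφA hm, lintegral_map hφ hm,
      lintegral_prod _ hφAm.aemeasurable, lintegral_prod _ hφm.aemeasurable]
    -- Write A H_k(w) V = H_k(A w) B V with B in the smaller group; invariance of μ absorbs B. The
    -- remaining rotation of w is then absorbed by the Gaussian law.
    have hstep : ∀ᵐ w ∂ginibreVec n, ∫⁻ V, φ (A * (genHouseholder k w * V)) ∂μ =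
        ∫⁻ V, φ (genHouseholder k (A *ᵥ w) * V) ∂μ := by
      filter_upwards [ae_tailVec_ne_zero hk1 hkn] with w hw
      have hB := genHouseholder_mul_mul_mem_fixOrth hk1 hkn hA hw
      set B := genHouseholder k (A *ᵥ w) * (A * genHouseholder k w) with hBdef
      have hfac : ∀ V, A * (genHouseholder k w * V) = genHouseholder k (A *ᵥ w) * (B * V) := by
        intro V
        rw [hBdef, ← mul_assoc, ← mul_assoc, ← mul_assoc, genHouseholder_mul_self, one_mul]
      simp only [hfac]
      conv_rhs => rw [← hμ.map_mul_left B hB]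
      exact (lintegral_map (hφ.comp (measurable_mul_left_matrix _))
        (measurable_mul_left_matrix B)).symm
    have hF : Measurable fun w : Vec n => ∫⁻ V, φ (genHouseholder k w * V) ∂μ :=
      (hφ.comp hm).lintegral_prod_right'
    rw [lintegral_congr_ae hstep]
    conv_rhs => rw [← ginibreVec_map_mulVec hA]
    exact (lintegral_map hF (measurable_matrix_mulVec measurable_const measurable_id)).symm

/-- The law of `H_{n-j+1}(g_{n-j+1}) ⋯ H_n(g_n)` for independent Gaussian vectors. -/
def tailLaw (n : ℕ) : ℕ → Measure (Matrix (Fin n) (Fin n) ℝ)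
  | 0 => Measure.dirac 1
  | j + 1 => ((ginibreVec n).prod (tailLaw n j)).map fun q => genHouseholder (n - j) q.1 * q.2

/-- The invariant probability measure on `fixOrth n k`. -/
def fixHaar (n k : ℕ) : Measure (Matrix (Fin n) (Fin n) ℝ) := tailLaw n (n - k)

lemma isFixHaar_fixHaar {k : ℕ} (hk : k ≤ n) : IsFixHaar k (fixHaar n k) := by
  -- The group grows with j, starting from the trivial group at j = 0.
  have key : ∀ j ≤ n, IsFixHaar (n - j) (tailLaw n j) := by
    intro j hj
    induction j with
    | zero => exact isFixHaar_dirac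
    | succ j ih => exact (ih (by omega)).genHouseholder_mul (by omega) (Nat.sub_le n j)
  have := key (n - k) (Nat.sub_le n k)
  rwa [Nat.sub_sub_self hk] at this

/-- Lets uniqueness identify Haar measure with the product of Gaussian reflectors. -/
lemma isFixHaar_haarO (n : ℕ) : IsFixHaar 0 ((haarO n).map Subtype.val) := by
  have hprob : IsProbabilityMeasure (haarO n) := ⟨by
    unfold haarO
    exact Measure.haarMeasure_self (K₀ := (⊤ : TopologicalSpace.PositiveCompacts (OGroup n)))⟩
  have hval : Measurable (Subtype.val : OGroup n → Matrix (Fin n) (Fin n) ℝ) :=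
    continuous_subtype_val.measurable
  refine ⟨Measure.isProbabilityMeasure_map hval.aemeasurable, ?_, fun A hA => ?_⟩
  · rw [ae_map_iff hval.aemeasurable (measurableSet_fixOrth n 0)]
    filter_upwards with U
    exact mem_fixOrth_zero_iff.mpr U.2
  · let U : OGroup n := ⟨A, mem_fixOrth_zero_iff.mp hA⟩
    have hU : Measurable fun V : OGroup n => U * V := (continuous_const_mul U).measurable
    have hinv : (haarO n).map (fun V => U * V) = haarO n := by
      unfold haarO
      exact map_mul_left_eq_self _ U
    rw [Measure.map_map (measurable_mul_left_matrix A) hval]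
    have : (fun B : Matrix (Fin n) (Fin n) ℝ => A * B) ∘ (Subtype.val : OGroup n → _) =
        Subtype.val ∘ fun V => U * V := rfl
    rw [this, ← Measure.map_map hval hU, hinv]

lemma fixHaar_zero (n : ℕ) : fixHaar n 0 = (haarO n).map Subtype.val :=
  (isFixHaar_fixHaar (Nat.zero_le n)).eq (isFixHaar_haarO n)

end

section

variable {n d : ℕ}

/-! ### The algorithm as a direct simulation -/

lemma prodAsc_congr {A B : ℕ → Matrix (Fin n) (Fin n) ℝ} {t : ℕ} (h : ∀ i ≤ t, A i = B i) :
    prodAsc A t = prodAsc B t := by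
  induction t with
  | zero => exact h 0 le_rfl
  | succ t ih => simp only [prodAsc, ih fun i hi => h i (by omega), h (t + 1) le_rfl]

lemma prodDesc_congr {A B : ℕ → Matrix (Fin n) (Fin n) ℝ} {t : ℕ} (h : ∀ i ≤ t, A i = B i) :
    prodDesc A t = prodDesc B t := by
  induction t with
  | zero => exact h 0 le_rfl
  | succ t ih => simp only [prodDesc, ih fun i hi => h i (by omega), h (t + 1) le_rfl]

lemma prodAsc_update_succ (A : ℕ → Matrix (Fin n) (Fin n) ℝ) (t : ℕ)
    (B : Matrix (Fin n) (Fin n) ℝ) :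
    prodAsc (Function.update A (t + 1) B) (t + 1) = prodAsc A t * B := by
  rw [prodAsc, Function.update_self, prodAsc_congr fun i hi =>
    Function.update_of_ne (show i ≠ t + 1 by omega) B A]

lemma prodDesc_update_succ (A : ℕ → Matrix (Fin n) (Fin n) ℝ) (t : ℕ)
    (B : Matrix (Fin n) (Fin n) ℝ) :
    prodDesc (Function.update A (t + 1) B) (t + 1) = B * prodDesc A t := by
  rw [prodDesc, Function.update_self, prodDesc_congr fun i hi =>
    Function.update_of_ne (show i ≠ t + 1 by omega) B A]

variable {side : ℕ → Side} {f : ℕ → Vec n → (Fin (d + 1) → Vec n) → Vec n}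

lemma hdStep_of_direct {t : ℕ} (h : side (t + 1) = .direct) (g : Vec n) (s : HDState n) :
    hdStep side f (t + 1) g s =
      ⟨Function.update s.x (((t + 1 : ℕ) : ℤ) + 1)
        (f (t + 1) ((prodAsc s.L t * genHouseholder (t + 1) g) *ᵥ
          (genHouseholder (t + 1) (prodDesc s.R t *ᵥ s.x (t + 1 : ℕ)) *ᵥ
            (prodDesc s.R t *ᵥ s.x (t + 1 : ℕ)))) (history d s.x (t + 1 : ℕ))),
        Function.update s.L (t + 1) (genHouseholder (t + 1) g),
        Function.update s.R (t + 1) (genHouseholder (t + 1) (prodDesc s.R t *ᵥ s.x (t + 1 : ℕ)))⟩ := by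
  simp only [hdStep, h, add_tsub_cancel_right, prodAsc_update_succ, Function.update_self]

lemma hdStep_of_transpose {t : ℕ} (h : side (t + 1) = .transpose) (g : Vec n) (s : HDState n) :
    hdStep side f (t + 1) g s =
      ⟨Function.update s.x (((t + 1 : ℕ) : ℤ) + 1)
        (f (t + 1) ((prodAsc s.R t * genHouseholder (t + 1) g) *ᵥ
          (genHouseholder (t + 1) (prodDesc s.L t *ᵥ s.x (t + 1 : ℕ)) *ᵥ
            (prodDesc s.L t *ᵥ s.x (t + 1 : ℕ)))) (history d s.x (t + 1 : ℕ))),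
        Function.update s.L (t + 1) (genHouseholder (t + 1) (prodDesc s.L t *ᵥ s.x (t + 1 : ℕ))),
        Function.update s.R (t + 1) (genHouseholder (t + 1) g)⟩ := by
  simp only [hdStep, h, add_tsub_cancel_right, prodAsc_update_succ, Function.update_self]

/-- The reflectors added in one iteration. -/
lemma hdStep_reflectors (t : ℕ) (g : Vec n) (s : HDState n) :
    ∃ p q : Vec n,
      (hdStep side f (t + 1) g s).L = Function.update s.L (t + 1) (genHouseholder (t + 1) p) ∧
      (hdStep side f (t + 1) g s).R = Function.update s.R (t + 1) (genHouseholder (t + 1) q) := by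
  cases h : side (t + 1) with
  | direct => rw [hdStep_of_direct h]; exact ⟨_, _, rfl, rfl⟩
  | transpose => rw [hdStep_of_transpose h]; exact ⟨_, _, rfl, rfl⟩

/-- Reflectors are symmetric, so transposing only reverses the order; needed to compute Qᵀ. -/
lemma hdRun_prodAsc_transpose (x0 : InitCond n d) (g : ℕ → Vec n) (t : ℕ) :
    (prodAsc (hdRun side f x0 g t).L t)ᵀ = prodDesc (hdRun side f x0 g t).L t ∧
    (prodAsc (hdRun side f x0 g t).R t)ᵀ = prodDesc (hdRun side f x0 g t).R t := by
  induction t with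
  | zero => simp [hdRun, prodAsc, prodDesc]
  | succ t ih =>
    obtain ⟨p, q, hL, hR⟩ := hdStep_reflectors (side := side) (f := f) t (g (t + 1))
      (hdRun side f x0 g t)
    rw [hdRun, hL, hR, prodAsc_update_succ, prodAsc_update_succ, prodDesc_update_succ,
      prodDesc_update_succ, transpose_mul, transpose_mul, ih.1, ih.2, genHouseholder_transpose,
      genHouseholder_transpose]
    exact ⟨rfl, rfl⟩

/-- The matrix `L₀ ⋯ L_t V R_t ⋯ R₀` after `t` iterations. -/
def hdMatrix (side : ℕ → Side) (f : ℕ → Vec n → (Fin (d + 1) → Vec n) → Vec n)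
    (x0 : InitCond n d) (g : ℕ → Vec n) (t : ℕ) (V : Matrix (Fin n) (Fin n) ℝ) :
    Matrix (Fin n) (Fin n) ℝ :=
  prodAsc (hdRun side f x0 g t).L t * V * prodDesc (hdRun side f x0 g t).R t

/-- Reflectors of iterations after t fix the first t basis vectors, so they merge with V into the
middle factor. -/
lemma hdMatrix_eq_of_le {T : ℕ} (hT : T ≤ n) (x0 : InitCond n d) (g : ℕ → Vec n)
    {V : Matrix (Fin n) (Fin n) ℝ} (hV : V ∈ fixOrth n T) {t : ℕ} (ht : t ≤ T) :
    ∃ E ∈ fixOrth n t, hdMatrix side f x0 g T V = hdMatrix side f x0 g t E := by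
  induction ht using Nat.decreasingInduction with
  | self => exact ⟨V, hV, rfl⟩
  | of_succ t ht ih =>
    obtain ⟨E, hE, hEq⟩ := ih
    obtain ⟨p, q, hL, hR⟩ := hdStep_reflectors (side := side) (f := f) t (g (t + 1))
      (hdRun side f x0 g t)
    refine ⟨genHouseholder (t + 1) p * E * genHouseholder (t + 1) q, ?_, ?_⟩
    · have h1 : 1 ≤ t + 1 := by omega
      have h2 : t + 1 ≤ n := by omega
      exact mul_mem (mul_mem (genHouseholder_mem_fixOrth h1 h2 p)
        (fixOrth_anti (Nat.le_succ t) hE)) (genHouseholder_mem_fixOrth h1 h2 q)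
    · rw [hEq, hdMatrix, hdMatrix, hdRun, hL, hR, prodAsc_update_succ, prodDesc_update_succ]
      simp only [mul_assoc]

/-- With `Q = L₀ ⋯ L_T V R_T ⋯ R₀` the direct simulation reproduces the algorithm. -/
lemma directRun_hdMatrix {T : ℕ} (hT : T ≤ n) (x0 : InitCond n d) (g : ℕ → Vec n)
    {V : Matrix (Fin n) (Fin n) ℝ} (hV : V ∈ fixOrth n T) {t : ℕ} (ht : t ≤ T) :
    directRun side f x0 (hdMatrix side f x0 g T V) t = (hdRun side f x0 g t).x := by
  induction t with
  | zero => rfl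
  | succ t ih =>
    have h1 : 1 ≤ t + 1 := by omega
    have h2 : t + 1 ≤ n := by omega
    obtain ⟨E, hE, hQ⟩ := hdMatrix_eq_of_le (side := side) (f := f) hT x0 g hV ht
    simp only [directRun, ih (by omega), hdRun]
    have htr := hdRun_prodAsc_transpose (side := side) (f := f) x0 g t
    -- The reflected vector has no coordinates beyond t + 1, so the undetermined middle factor
    -- cannot affect it.
    have hfix : ∀ p : Vec n, ∀ B ∈ fixOrth n (t + 1),
        B *ᵥ genHouseholder (t + 1) p *ᵥ p = genHouseholder (t + 1) p *ᵥ p := fun p B hB =>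
      mulVec_eq_self_of_mem_fixOrth hB fun i hi => genHouseholder_mulVec_self_apply h1 h2 p hi
    cases h : side (t + 1) with
    | direct =>
      rw [hdStep_of_direct h]
      congr 2
      rw [hQ, hdMatrix, hdRun, hdStep_of_direct h]
      simp only [Side.apply, prodAsc_update_succ, prodDesc_update_succ]
      simp only [← mulVec_mulVec]
      rw [hfix _ E hE]
    | transpose =>
      rw [hdStep_of_transpose h]
      congr 2
      rw [hQ, hdMatrix, hdRun, hdStep_of_transpose h]
      simp only [Side.apply, prodAsc_update_succ, prodDesc_update_succ, transpose_mul,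
        genHouseholder_transpose, ← htr.2, transpose_transpose, htr.1]
      simp only [← mulVec_mulVec]
      rw [hfix _ _ (transpose_mem_fixOrth hE)]

/-- After `t` iterations the state depends only on `g₁, …, g_t`. -/
lemma hdRun_congr (x0 : InitCond n d) {g g' : ℕ → Vec n} {t : ℕ}
    (h : ∀ i ∈ Finset.Icc 1 t, g i = g' i) : hdRun side f x0 g t = hdRun side f x0 g' t := by
  induction t with
  | zero => rfl
  | succ t ih =>
    rw [hdRun, hdRun, ih fun i hi => h i (by simp at hi ⊢; omega), h (t + 1) (by simp)]

end

section

variable {n d : ℕ} {side : ℕ → Side} {f : ℕ → Vec n → (Fin (d + 1) → Vec n) → Vec n}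

/-! ### Measurability of the simulations -/

section Measurability

variable {α : Type*} [MeasurableSpace α]

lemma measurable_prodAsc {A : α → ℕ → Matrix (Fin n) (Fin n) ℝ}
    (hA : ∀ i, Measurable fun a => A a i) (t : ℕ) : Measurable fun a => prodAsc (A a) t := by
  induction t with
  | zero => exact hA 0
  | succ t ih => exact measurable_matrix_mul ih (hA (t + 1))

lemma measurable_prodDesc {A : α → ℕ → Matrix (Fin n) (Fin n) ℝ}
    (hA : ∀ i, Measurable fun a => A a i) (t : ℕ) : Measurable fun a => prodDesc (A a) t := by
  induction t with
  | zero => exact hA 0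
  | succ t ih => exact measurable_matrix_mul (hA (t + 1)) ih

lemma measurable_update_family {ι β : Type*} [DecidableEq ι] [MeasurableSpace β]
    {F : α → ι → β} {b : α → β} (hF : ∀ i, Measurable fun a => F a i) (hb : Measurable b) (j : ι) :
    ∀ i, Measurable fun a => Function.update (F a) j (b a) i := by
  intro i
  by_cases h : i = j
  · subst h; simpa using hb
  · simpa [Function.update_of_ne h] using hF i

lemma measurable_initArray {x0 : α → InitCond n d} (hx0 : Measurable x0) (i : ℤ) :
    Measurable fun a => initArray (x0 a) i := by
  unfold initArray
  by_cases h : i ∈ Set.Icc (1 - (d : ℤ)) 1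
  · simp only [dif_pos h]; exact measurable_pi_iff.mp hx0 _
  · simp only [dif_neg h]; exact measurable_const

lemma measurable_apply_history {F : Vec n → (Fin (d + 1) → Vec n) → Vec n}
    (hF : Measurable (Function.uncurry F)) {y : α → Vec n} (hy : Measurable y) {x : α → ℤ → Vec n}
    (hx : ∀ i, Measurable fun a => x a i) (t : ℤ) :
    Measurable fun a => F (y a) (history d (x a) t) :=
  hF.comp (hy.prodMk (measurable_pi_iff.mpr fun i => hx (t - i)))

lemma measurable_hdRun {T : ℕ} (hf : ∀ t ∈ Finset.Icc 1 T, Measurable (Function.uncurry (f t)))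
    {x0 : α → InitCond n d} (hx0 : Measurable x0) {g : α → ℕ → Vec n}
    (hg : ∀ i, Measurable fun a => g a i) {t : ℕ} (ht : t ≤ T) :
    (∀ i, Measurable fun a => (hdRun side f (x0 a) (g a) t).x i) ∧
    (∀ i, Measurable fun a => (hdRun side f (x0 a) (g a) t).L i) ∧
    (∀ i, Measurable fun a => (hdRun side f (x0 a) (g a) t).R i) := by
  induction t with
  | zero => exact ⟨measurable_initArray hx0, fun _ => measurable_const, fun _ => measurable_const⟩
  | succ t ih =>
    obtain ⟨hx, hL, hR⟩ := ih (by omega)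
    have hft := hf (t + 1) (by simp; omega)
    have hH {p : α → Vec n} (hp : Measurable p) :
        Measurable fun a => genHouseholder (t + 1) (p a) :=
      (measurable_genHouseholder (t + 1)).comp hp
    cases h : side (t + 1) with
    | direct =>
      simp only [hdRun, hdStep_of_direct h]
      have hp := measurable_matrix_mulVec (measurable_prodDesc hR t) (hx (t + 1 : ℕ))
      refine ⟨measurable_update_family hx (measurable_apply_history hft ?_ hx _) _,
        measurable_update_family hL (hH (hg _)) _, measurable_update_family hR (hH hp) _⟩
      exact measurable_matrix_mulVec (measurable_matrix_mul (measurable_prodAsc hL t) (hH (hg _)))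
        (measurable_matrix_mulVec (hH hp) hp)
    | transpose =>
      simp only [hdRun, hdStep_of_transpose h]
      have hp := measurable_matrix_mulVec (measurable_prodDesc hL t) (hx (t + 1 : ℕ))
      refine ⟨measurable_update_family hx (measurable_apply_history hft ?_ hx _) _,
        measurable_update_family hL (hH hp) _, measurable_update_family hR (hH (hg _)) _⟩
      exact measurable_matrix_mulVec (measurable_matrix_mul (measurable_prodAsc hR t) (hH (hg _)))
        (measurable_matrix_mulVec (hH hp) hp)

lemma measurable_hdMatrix {T : ℕ} (hf : ∀ t ∈ Finset.Icc 1 T, Measurable (Function.uncurry (f t)))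
    {x0 : α → InitCond n d} (hx0 : Measurable x0) {g : α → ℕ → Vec n}
    (hg : ∀ i, Measurable fun a => g a i) {V : α → Matrix (Fin n) (Fin n) ℝ} (hV : Measurable V)
    {t : ℕ} (ht : t ≤ T) : Measurable fun a => hdMatrix side f (x0 a) (g a) t (V a) := by
  obtain ⟨-, hL, hR⟩ := measurable_hdRun (side := side) hf hx0 hg ht
  exact measurable_matrix_mul (measurable_matrix_mul (measurable_prodAsc hL t) hV)
    (measurable_prodDesc hR t)

lemma measurable_directRun {T : ℕ}
    (hf : ∀ t ∈ Finset.Icc 1 T, Measurable (Function.uncurry (f t)))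
    {x0 : α → InitCond n d} (hx0 : Measurable x0) {Q : α → Matrix (Fin n) (Fin n) ℝ}
    (hQ : Measurable Q) {t : ℕ} (ht : t ≤ T) (i : ℤ) :
    Measurable fun a => directRun side f (x0 a) (Q a) t i := by
  induction t generalizing i with
  | zero => exact measurable_initArray hx0 i
  | succ t ih =>
    have hx := ih (by omega)
    have hft := hf (t + 1) (by simp; omega)
    have hM : Measurable fun a => (side (t + 1)).apply (Q a) := by
      cases side (t + 1) with
      | direct => exact hQ
      | transpose => exact measurable_matrix_transpose hQ
    exact measurable_update_family hx (measurable_apply_history hft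
      (measurable_matrix_mulVec hM (hx _)) hx _) _ i

end Measurability

/-! ### The law of the matrix built by the algorithm -/

/-- Replacing one coordinate by an independent copy preserves a product law; this isolates the
integral over one Gaussian vector. -/
lemma pi_map_update {ι : Type*} [Fintype ι] [DecidableEq ι] {X : ι → Type*}
    [∀ i, MeasurableSpace (X i)] (μ : ∀ i, Measure (X i)) [∀ i, IsProbabilityMeasure (μ i)]
    (i : ι) : ((Measure.pi μ).prod (μ i)).map (fun q => Function.update q.1 i q.2) =
      Measure.pi μ := by
  have hm : Measurable fun q : (∀ j, X j) × X i => Function.update q.1 i q.2 :=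
    measurable_update'
  refine (Measure.pi_eq fun s hs => ?_).symm
  rw [Measure.map_apply hm (MeasurableSet.univ_pi hs)]
  have hpre : (fun q : (∀ j, X j) × X i => Function.update q.1 i q.2) ⁻¹' Set.univ.pi s =
      (Set.univ.pi (Function.update s i Set.univ)) ×ˢ s i := by
    ext ⟨x, y⟩
    simp only [Set.mem_preimage, Set.mem_univ_pi, Set.mem_prod]
    constructor
    · intro h
      refine ⟨fun j => ?_, by simpa using h i⟩
      by_cases hj : j = i
      · subst hj; simp
      · simpa [Function.update_of_ne hj] using h j
    · rintro ⟨h, hy⟩ j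
      by_cases hj : j = i
      · subst hj; simpa using hy
      · simpa [Function.update_of_ne hj] using h j
  rw [hpre, Measure.prod_prod, Measure.pi_pi,
    ← Finset.prod_erase_mul _ (fun j => μ j (s j)) (Finset.mem_univ i),
    ← Finset.prod_erase_mul _ _ (Finset.mem_univ i)]
  simp only [Function.update_self, measure_univ, mul_one]
  congr 1
  refine Finset.prod_congr rfl fun j hj => ?_
  rw [Function.update_of_ne (Finset.ne_of_mem_erase hj)]

lemma lintegral_genHouseholder_mul {k : ℕ} (hk : k + 1 ≤ n)
    {ψ : Matrix (Fin n) (Fin n) ℝ → ENNReal} (hψ : Measurable ψ) :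
    ∫⁻ w, ∫⁻ V, ψ (genHouseholder (k + 1) w * V) ∂fixHaar n (k + 1) ∂ginibreVec n =
      ∫⁻ W, ψ W ∂fixHaar n k := by
  have h1 := isFixHaar_fixHaar hk
  have := h1.prob
  have hm := measurable_genHouseholder_mul (n := n) (k + 1)
  rw [(isFixHaar_fixHaar (show k ≤ n by omega)).eq (h1.genHouseholder_mul (by omega) hk),
    lintegral_map hψ hm]
  exact (lintegral_prod (fun q : Vec n × Matrix (Fin n) (Fin n) ℝ =>
    ψ (genHouseholder (k + 1) q.1 * q.2)) (hψ.comp hm).aemeasurable).symm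

/-- Mirror image of the previous identity: the invariant laws are transposition invariant and
reflectors are symmetric. -/
lemma lintegral_mul_genHouseholder {k : ℕ} (hk : k + 1 ≤ n)
    {ψ : Matrix (Fin n) (Fin n) ℝ → ENNReal} (hψ : Measurable ψ) :
    ∫⁻ w, ∫⁻ V, ψ (V * genHouseholder (k + 1) w) ∂fixHaar n (k + 1) ∂ginibreVec n =
      ∫⁻ W, ψ W ∂fixHaar n k := by
  have hψt : Measurable fun W : Matrix (Fin n) (Fin n) ℝ => ψ Wᵀ :=
    hψ.comp measurable_transpose_matrix
  have h0 : ∫⁻ W, ψ W ∂fixHaar n k = ∫⁻ W, ψ Wᵀ ∂fixHaar n k := by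
    conv_lhs => rw [← (isFixHaar_fixHaar (show k ≤ n by omega)).map_transpose]
    exact lintegral_map hψ measurable_transpose_matrix
  rw [h0, ← lintegral_genHouseholder_mul hk hψt]
  refine lintegral_congr fun w => ?_
  conv_lhs => rw [← (isFixHaar_fixHaar hk).map_transpose]
  refine (lintegral_map (hψ.comp (measurable_mul_right_matrix _))
    measurable_transpose_matrix).trans ?_
  simp [transpose_mul, genHouseholder_transpose]

/-- Extend a family indexed by `{1, …, T}` by zero. -/
def extendSeq (T : ℕ) (g : Finset.Icc 1 T → Vec n) : ℕ → Vec n := fun t =>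
  if h : t ∈ Finset.Icc 1 T then g ⟨t, h⟩ else 0

lemma measurable_extendSeq {α : Type*} [MeasurableSpace α] {T : ℕ}
    {g : α → Finset.Icc 1 T → Vec n} (hg : Measurable g) (i : ℕ) :
    Measurable fun a => extendSeq T (g a) i := by
  unfold extendSeq
  by_cases h : i ∈ Finset.Icc 1 T
  · simp only [dif_pos h]; exact measurable_pi_iff.mp hg _
  · simp only [dif_neg h]; exact measurable_const

/-- The new middle factor is H(w) V H(p), or H(p) V H(w) in a transposed iteration. The Gaussian
reflector enlarges the invariant law, and H(p), which does not depend on w, is absorbed by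
invariance. -/
lemma lintegral_hdMatrix_succ {t : ℕ} (ht : t + 1 ≤ n) (x0 : InitCond n d) (g : ℕ → Vec n)
    {φ : Matrix (Fin n) (Fin n) ℝ → ENNReal} (hφ : Measurable φ) :
    ∫⁻ w, ∫⁻ V, φ (hdMatrix side f x0 (Function.update g (t + 1) w) (t + 1) V)
      ∂fixHaar n (t + 1) ∂ginibreVec n =
    ∫⁻ V, φ (hdMatrix side f x0 g t V) ∂fixHaar n t := by
  have hrun : ∀ w, hdRun side f x0 (Function.update g (t + 1) w) t = hdRun side f x0 g t :=
    fun w => hdRun_congr x0 fun i hi => Function.update_of_ne (by simp at hi; omega) _ _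
  have hmeas : ∀ A B : Matrix (Fin n) (Fin n) ℝ, Measurable fun W => φ (A * W * B) := fun A B =>
    hφ.comp ((measurable_mul_right_matrix B).comp (measurable_mul_left_matrix A))
  have hfix := isFixHaar_fixHaar (show t ≤ n by omega)
  unfold hdMatrix
  simp only [hdRun, Function.update_self, hrun]
  set S := hdRun side f x0 g t
  cases h : side (t + 1) with
  | direct =>
    simp only [hdStep_of_direct h, prodAsc_update_succ, prodDesc_update_succ]
    set H := genHouseholder (t + 1) (prodDesc S.R t *ᵥ S.x (t + 1 : ℕ))
    have hH : H ∈ fixOrth n t := genHouseholder_mem_fixOrth (by omega) ht _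
    have h1 := lintegral_genHouseholder_mul ht (hmeas (prodAsc S.L t) (H * prodDesc S.R t))
    simp only [← mul_assoc] at h1 ⊢
    rw [h1]
    conv_rhs => rw [← hfix.map_mul_right hH]
    rw [lintegral_map (hmeas _ _) (measurable_mul_right_matrix H)]
    simp only [← mul_assoc]
  | transpose =>
    simp only [hdStep_of_transpose h, prodAsc_update_succ, prodDesc_update_succ]
    set H := genHouseholder (t + 1) (prodDesc S.L t *ᵥ S.x (t + 1 : ℕ))
    have hH : H ∈ fixOrth n t := genHouseholder_mem_fixOrth (by omega) ht _
    have h1 := lintegral_mul_genHouseholder ht (hmeas (prodAsc S.L t * H) (prodDesc S.R t))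
    simp only [← mul_assoc] at h1 ⊢
    rw [h1]
    conv_rhs => rw [← hfix.map_mul_left H hH]
    rw [lintegral_map (hmeas _ _) (measurable_mul_left_matrix H)]
    simp only [← mul_assoc]

/-- For a deterministic initial condition, `L₀ ⋯ L_t V R_t ⋯ R₀` is Haar distributed. -/
lemma lintegral_hdMatrix {T : ℕ} (hT : T ≤ n)
    (hf : ∀ t ∈ Finset.Icc 1 T, Measurable (Function.uncurry (f t))) (x0 : InitCond n d)
    {φ : Matrix (Fin n) (Fin n) ℝ → ENNReal} (hφ : Measurable φ) {t : ℕ} (ht : t ≤ T) :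
    ∫⁻ g, ∫⁻ V, φ (hdMatrix side f x0 (extendSeq T g) t V) ∂fixHaar n t
      ∂Measure.pi (fun _ : Finset.Icc 1 T => ginibreVec n) = ∫⁻ V, φ V ∂fixHaar n 0 := by
  induction t with
  | zero => simp [hdMatrix, hdRun, prodAsc, prodDesc]
  | succ t ih =>
    have hmem : t + 1 ∈ Finset.Icc 1 T := by simp; omega
    have := (isFixHaar_fixHaar (show t + 1 ≤ n by omega)).prob
    have hF : Measurable fun g : Finset.Icc 1 T → Vec n =>
        ∫⁻ V, φ (hdMatrix side f x0 (extendSeq T g) (t + 1) V) ∂fixHaar n (t + 1) :=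
      Measurable.lintegral_prod_right (f := fun g : Finset.Icc 1 T → Vec n => fun V =>
        φ (hdMatrix side f x0 (extendSeq T g) (t + 1) V)) (hφ.comp (measurable_hdMatrix hf
          measurable_const (measurable_extendSeq measurable_fst) measurable_snd ht))
    have hm : Measurable fun q : (Finset.Icc 1 T → Vec n) × Vec n =>
        Function.update q.1 ⟨t + 1, hmem⟩ q.2 := measurable_update'
    have hext : ∀ (g : Finset.Icc 1 T → Vec n) (w : Vec n),
        extendSeq T (Function.update g ⟨t + 1, hmem⟩ w) =
          Function.update (extendSeq T g) (t + 1) w := by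
      intro g w
      ext1 i
      by_cases hi : i = t + 1
      · subst hi; simp [extendSeq, hmem]
      · simp only [extendSeq, Function.update_of_ne hi]
        split_ifs with h
        · rw [Function.update_of_ne (by simpa using hi)]
        · rfl
    rw [← ih (by omega)]
    -- Resample g_{t+1}, so that it is integrated with the other vectors held fixed.
    conv_lhs => rw [← pi_map_update (fun _ : Finset.Icc 1 T => ginibreVec n) ⟨t + 1, hmem⟩]
    rw [lintegral_map hF hm]
    refine (lintegral_prod _ (hF.comp hm).aemeasurable).trans ?_
    refine lintegral_congr fun g => ?_
    simp only [Function.comp_apply, hext]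
    exact lintegral_hdMatrix_succ (by omega) x0 (extendSeq T g) hφ

end

section

variable {n d : ℕ} {side : ℕ → Side} {f : ℕ → Vec n → (Fin (d + 1) → Vec n) → Vec n}

/-! ### Equality of the laws of the iterates -/

lemma measurable_iterates_hdRun {T : ℕ}
    (hf : ∀ t ∈ Finset.Icc 1 T, Measurable (Function.uncurry (f t))) :
    Measurable fun q : InitCond n d × (Finset.Icc 1 T → Vec n) =>
      iterates d T (hdRun side f q.1 (extendSeq T q.2) T).x :=
  measurable_pi_iff.mpr fun i => (measurable_hdRun hf measurable_fst
    (measurable_extendSeq measurable_snd) le_rfl).1 i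

lemma measurable_iterates_directRun {T : ℕ}
    (hf : ∀ t ∈ Finset.Icc 1 T, Measurable (Function.uncurry (f t))) :
    Measurable fun q : InitCond n d × Matrix (Fin n) (Fin n) ℝ =>
      iterates d T (directRun side f q.1 q.2 T) :=
  measurable_pi_iff.mpr fun i => measurable_directRun hf measurable_fst measurable_snd le_rfl i

/-- The two simulations agree in law for a deterministic initial condition. -/
lemma lintegral_iterates_hdRun {T : ℕ} (hT : T ≤ n)
    (hf : ∀ t ∈ Finset.Icc 1 T, Measurable (Function.uncurry (f t))) (x0 : InitCond n d)
    {φ : (Set.Icc (1 - (d : ℤ)) ((T : ℤ) + 1) → Vec n) → ENNReal} (hφ : Measurable φ) :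
    ∫⁻ g, φ (iterates d T (hdRun side f x0 (extendSeq T g) T).x)
      ∂Measure.pi (fun _ : Finset.Icc 1 T => ginibreVec n) =
    ∫⁻ A, φ (iterates d T (directRun side f x0 A T)) ∂fixHaar n 0 := by
  have hfix := isFixHaar_fixHaar hT
  have := hfix.prob
  have hψ : Measurable fun A : Matrix (Fin n) (Fin n) ℝ =>
      φ (iterates d T (directRun side f x0 A T)) :=
    hφ.comp ((measurable_iterates_directRun hf).comp measurable_prodMk_left)
  rw [← lintegral_hdMatrix (side := side) hT hf x0 hψ le_rfl]
  refine lintegral_congr fun g => ?_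
  -- By the pathwise identity the integrand is almost surely constant in V, and V has total mass
  -- one.
  have : ∀ᵐ V ∂fixHaar n T, φ (iterates d T (directRun side f x0
      (hdMatrix side f x0 (extendSeq T g) T V) T)) =
        φ (iterates d T (hdRun side f x0 (extendSeq T g) T).x) := by
    filter_upwards [hfix.ae_mem] with V hV
    rw [directRun_hdMatrix hT x0 (extendSeq T g) hV le_rfl]
  rw [lintegral_congr_ae this]
  simp

end

end

end HouseholderDice

/-! ### Random initial conditions -/

open HouseholderDice in
/-- `X0, g` are the initial condition and the Gaussian vectors fed to the Householder Dice
algorithm; `X0', Q` are the initial condition and the Haar matrix of the direct simulation, possibly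
on another probability space. Taking the same space and `X0' = X0` is allowed. -/
theorem theorem2
    {Ω Ω' : Type*} [MeasurableSpace Ω] [MeasurableSpace Ω']
    (P : Measure Ω) [IsProbabilityMeasure P] (P' : Measure Ω') [IsProbabilityMeasure P']
    (n d T : ℕ) (hT : T ≤ n)
    (side : ℕ → Side)
    (f : ℕ → Vec n → (Fin (d + 1) → Vec n) → Vec n)
    (hf : ∀ t ∈ Finset.Icc 1 T, Measurable (Function.uncurry (f t)))
    (X0 : Ω → InitCond n d) (g : ℕ → Ω → Vec n)
    (hg : ∀ t ∈ Finset.Icc 1 T, HasLaw (g t) (ginibreVec n) P)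
    (hgind : iIndepFun (fun (t : Finset.Icc 1 T) => g t) P)
    (hX0g : IndepFun X0 (fun ω (t : Finset.Icc 1 T) => g t ω) P)
    (X0' : Ω' → InitCond n d) (Q : Ω' → OGroup n)
    (hQ : HasLaw Q (haarO n) P')
    (hX0Q : IndepFun X0' Q P')
    (hX0 : IdentDistrib X0 X0' P P') :
    IdentDistrib
      (fun ω => iterates d T (hdRun side f (X0 ω) (fun t => g t ω) T).x)
      (fun ω' => iterates d T (directRun side f (X0' ω') (Q ω').1 T))
      P P' := by
  have hval : Measurable (Subtype.val : OGroup n → Matrix (Fin n) (Fin n) ℝ) :=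
    continuous_subtype_val.measurable
  -- Only g_1, …, g_T are read, so the sequence may be replaced by its zero extension.
  have hrun : (fun ω => iterates d T (hdRun side f (X0 ω) (fun t => g t ω) T).x) =
      (fun q : InitCond n d × (Finset.Icc 1 T → Vec n) =>
        iterates d T (hdRun side f q.1 (extendSeq T q.2) T).x) ∘
      fun ω => (X0 ω, fun t : Finset.Icc 1 T => g t ω) := by
    ext1 ω
    rw [Function.comp_apply, hdRun_congr (X0 ω)]
    intro i hi
    rw [extendSeq, dif_pos hi]
  have hdir : (fun ω' => iterates d T (directRun side f (X0' ω') (Q ω').1 T)) =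
      (fun q : InitCond n d × Matrix (Fin n) (Fin n) ℝ =>
        iterates d T (directRun side f q.1 q.2 T)) ∘ fun ω' => (X0' ω', (Q ω').1) := rfl
  have hm := measurable_iterates_hdRun (side := side) hf
  have hm' := measurable_iterates_directRun (side := side) hf
  have hgm : ∀ t : Finset.Icc 1 T, AEMeasurable (g t) P := fun t => (hg t t.2).aemeasurable
  have hG : AEMeasurable (fun ω (t : Finset.Icc 1 T) => g t ω) P := aemeasurable_pi_iff.mpr hgm
  have hQm : AEMeasurable (fun ω' => (Q ω').1) P' := hval.comp_aemeasurable hQ.aemeasurable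
  have hlawG : P.map (fun ω (t : Finset.Icc 1 T) => g t ω) =
      Measure.pi fun _ : Finset.Icc 1 T => ginibreVec n := by
    rw [(iIndepFun_iff_map_fun_eq_pi_map hgm).mp hgind]
    congr 1
    ext1 t
    exact (hg t t.2).map_eq
  have hlawQ : P'.map (fun ω' => (Q ω').1) = fixHaar n 0 := by
    rw [fixHaar_zero, ← hQ.map_eq, AEMeasurable.map_map_of_aemeasurable hval.aemeasurable
      hQ.aemeasurable]
    rfl
  -- Independence makes both input laws products with the same first marginal, so Fubini reduces the
  -- claim to a fixed initial condition.
  have hjoint := (indepFun_iff_map_prod_eq_prod_map_map hX0.aemeasurable_fst hG).mp hX0g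
  have hjoint' := (indepFun_iff_map_prod_eq_prod_map_map hX0.aemeasurable_snd hQm).mp
    (hX0Q.comp measurable_id hval)
  rw [hlawG] at hjoint
  rw [hlawQ, ← hX0.map_eq] at hjoint'
  have hpair := hX0.aemeasurable_fst.prodMk hG
  have hpair' := hX0.aemeasurable_snd.prodMk hQm
  rw [hrun, hdir]
  refine ⟨hm.comp_aemeasurable hpair, hm'.comp_aemeasurable hpair', ?_⟩
  have := (isFixHaar_fixHaar (Nat.zero_le n)).prob
  have := Measure.isProbabilityMeasure_map hX0.aemeasurable_fst
  rw [← AEMeasurable.map_map_of_aemeasurable hm.aemeasurable hpair,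
    ← AEMeasurable.map_map_of_aemeasurable hm'.aemeasurable hpair', hjoint, hjoint']
  refine Measure.ext_of_lintegral _ fun φ hφ => ?_
  rw [lintegral_map hφ hm, lintegral_map hφ hm']
  refine (lintegral_prod _ (hφ.comp hm).aemeasurable).trans
    (Eq.trans ?_ (lintegral_prod _ (hφ.comp hm').aemeasurable).symm)
  exact lintegral_congr fun x0 => lintegral_iterates_hdRun hT hf x0 hφ
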